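/- Let $X\subset\mathbb{P}^4$ be a nodal quartic threefold over $\mathbb{C}$, that is, a hypersurface of degree $4$ all of whose singular points are nodes (simple double points: the quadratic part of a local equation of $X$ at the point is a nondegenerate quadratic form). Suppose that $X$ has at most $9$ singular points and that $X$ contains no plane (two-dimensional linear subspace of $\mathbb{P}^4$). Then the nodes of $X$ impose independent linear conditions on cubic hypersurfaces in $\mathbb{P}^4$; that is, the linear functionals on the space of cubic forms in five variables given by evaluation at vectors of homogeneous coordinates of the nodes are linearly independent. -/

import Mathlib

open MvPolynomial

noncomputable section

namespace QuarticThreefold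

/-- Complex projective four-space, as the set of lines in `ℂ⁵`. -/
abbrev P4 : Type := Projectivization ℂ (Fin 5 → ℂ)

/-- The points of the hypersurface `F = 0` in `ℙ⁴`. For homogeneous `F` the vanishing of `F` at a
point does not depend on the vector of homogeneous coordinates that is used. -/
def hypersurface (F : MvPolynomial (Fin 5) ℂ) : Set P4 :=
  {p | eval p.rep F = 0}

/-- The singular points of the hypersurface `F = 0` in `ℙ⁴`. -/
def Sing (F : MvPolynomial (Fin 5) ℂ) : Set P4 :=
  {p | p ∈ hypersurface F ∧ ∀ i, eval p.rep (pderiv i F) = 0}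

/-- The equation of the hypersurface `F = 0` in the affine chart `x i ≠ 0`, that is, `F` with `1`
substituted for the `i`-th variable and with the other four variables renamed in order. -/
def localEquation (F : MvPolynomial (Fin 5) ℂ) (i : Fin 5) : MvPolynomial (Fin 4) ℂ :=
  aeval (i.insertNth (α := fun _ => MvPolynomial (Fin 4) ℂ) 1 X) F

/-- The affine coordinates of a point of `ℙ⁴` in the chart `x i ≠ 0`. -/
def affineCoord (p : P4) (i : Fin 5) : Fin 4 → ℂ :=
  fun k => p.rep (i.succAbove k) / p.rep i

/-- The matrix of second partial derivatives of `f` at the point `a`. -/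
def hessian (f : MvPolynomial (Fin 4) ℂ) (a : Fin 4 → ℂ) : Matrix (Fin 4) (Fin 4) ℂ :=
  Matrix.of fun j k => eval a (pderiv j (pderiv k f))

/-- `p` is a node (simple double point) of the hypersurface `F = 0`: it is a singular point and the
quadratic part at `p` of a local equation of the hypersurface is a nondegenerate quadratic form. -/
def IsNode (F : MvPolynomial (Fin 5) ℂ) (p : P4) : Prop :=
  p ∈ Sing F ∧
    ∀ i : Fin 5, p.rep i ≠ 0 → (hessian (localEquation F i) (affineCoord p i)).det ≠ 0

/-- `F = 0` is a nodal quartic threefold in `ℙ⁴`: a hypersurface of degree four all of whose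
singular points are nodes. -/
structure IsNodalQuartic (F : MvPolynomial (Fin 5) ℂ) : Prop where
  ne_zero : F ≠ 0
  isHomogeneous : F.IsHomogeneous 4
  isNode_of_mem_Sing : ∀ p ∈ Sing F, IsNode F p

/-- The linear subspace of `ℙ⁴` given by a linear subspace `W` of `ℂ⁵`. -/
def linearSubspace (W : Submodule ℂ (Fin 5 → ℂ)) : Set P4 :=
  {p | p.submodule ≤ W}

/-- The hypersurface `F = 0` contains a plane (a two-dimensional linear subspace of `ℙ⁴`). -/
def ContainsPlane (F : MvPolynomial (Fin 5) ℂ) : Prop :=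
  ∃ W : Submodule ℂ (Fin 5 → ℂ), Module.finrank ℂ W = 3 ∧ linearSubspace W ⊆ hypersurface F

/-- The linear condition that a point `p` of `ℙ⁴` imposes on forms of degree `d`: the evaluation
functional at a vector of homogeneous coordinates of `p`, which is determined by `p` up to a nonzero
factor. Its kernel consists of the forms of degree `d` that vanish at `p`. -/
def condition (d : ℕ) (p : P4) : homogeneousSubmodule (Fin 5) ℂ d →ₗ[ℂ] ℂ :=
  (aeval p.rep : MvPolynomial (Fin 5) ℂ →ₐ[ℂ] ℂ).toLinearMap.domRestrict
    (homogeneousSubmodule (Fin 5) ℂ d)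

/-- The points of `S` impose independent linear conditions on hypersurfaces of degree `d`. -/
def ImposesIndependentConditions (S : Set P4) (d : ℕ) : Prop :=
  LinearIndependent ℂ (fun p : S => condition d (p : P4))

end QuarticThreefold

end

open Module

section Partition

variable {K V ι κ : Type*} [Field K] [AddCommGroup V] [Module K V] [FiniteDimensional K V]

theorem finrank_sup_span_singleton_le (U : Submodule K V) (x : V) :
    finrank K ↥(U ⊔ Submodule.span K {x}) ≤ finrank K U + 1 :=
  (Submodule.finrank_add_le_finrank_add_finrank _ _).trans
    (Nat.add_le_add_left ((finrank_span_le_card _).trans (by simp)) _)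

/-- A version of the matroid partition theorem for families of vectors: if `|A| + ∑ dim U i` is at
most `∑ dim (U i + span A)` for every subfamily `A` of `E`, then `E` can be coloured so that the
vectors of colour `i` are linearly independent modulo `U i`. -/
theorem exists_coloring_independent [DecidableEq ι] [DecidableEq κ] [Fintype κ] [Nonempty κ]
    (v : ι → V) (E : Finset ι) (U : κ → Submodule K V)
    (h : ∀ A ⊆ E, A.card + ∑ i, finrank K (U i) ≤
      ∑ i, finrank K ↥(U i ⊔ Submodule.span K (v '' A))) :
    ∃ c : ι → κ, ∀ i, finrank K ↥(U i ⊔ Submodule.span K (v '' (E.filter (c · = i) : Finset ι))) =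
      finrank K (U i) + (E.filter (c · = i)).card := by
  induction hn : E.card using Nat.strong_induction_on generalizing E U with
  | _ n ih =>
  subst hn
  by_cases hE : E = ∅
  · subst hE
    exact ⟨fun _ => Classical.arbitrary κ, fun i => by
      rw [Finset.filter_empty, Finset.coe_empty, Set.image_empty, Submodule.span_empty, sup_bot_eq,
        Finset.card_empty, add_zero]⟩
  by_cases ht : ∃ A ⊂ E, A.Nonempty ∧ ∑ i, finrank K ↥(U i ⊔ Submodule.span K (v '' A)) ≤
      A.card + ∑ i, finrank K (U i)
  · obtain ⟨A, hAE, hA, htight⟩ := ht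
    have htight := le_antisymm htight (h A hAE.1)
    obtain ⟨c₁, hc₁⟩ := ih _ (Finset.card_lt_card hAE) A U
      (fun B hB => h B (hB.trans hAE.1)) rfl
    obtain ⟨c₂, hc₂⟩ := ih (E \ A).card
      (Finset.card_lt_card (Finset.sdiff_ssubset hAE.1 hA)) (E \ A)
      (fun i => U i ⊔ Submodule.span K (v '' A)) (fun B hB => by
        have hd : Disjoint B A := Finset.disjoint_of_subset_left hB Finset.sdiff_disjoint
        have := h (B ∪ A) (Finset.union_subset (hB.trans Finset.sdiff_subset) hAE.1)
        rw [Finset.card_union_of_disjoint hd] at this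
        rw [htight, ← add_assoc]
        refine this.trans (Finset.sum_le_sum fun i _ => le_of_eq ?_)
        rw [Finset.coe_union, Set.image_union, Submodule.span_union, sup_assoc,
          sup_comm (Submodule.span K (v '' (B : Set ι)))]) rfl
    have hcard : ∑ i, (A.filter (c₁ · = i)).card = A.card :=
      (Finset.card_eq_sum_card_fiberwise (fun _ _ => Finset.mem_univ _)).symm
    have hle : ∀ i, U i ⊔ Submodule.span K (v '' (A.filter (c₁ · = i) : Finset ι)) ≤
        U i ⊔ Submodule.span K (v '' A) := fun i =>
      sup_le_sup_left (Submodule.span_mono (Set.image_mono (by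
        exact_mod_cast Finset.filter_subset _ _))) _
    have hsum : ∑ i, finrank K ↥(U i ⊔ Submodule.span K (v '' (A.filter (c₁ · = i) : Finset ι))) =
        ∑ i, finrank K ↥(U i ⊔ Submodule.span K (v '' A)) := by
      rw [htight, ← hcard, ← Finset.sum_add_distrib]
      exact Finset.sum_congr rfl fun i _ => by rw [hc₁ i, add_comm]
    have heq := (Finset.sum_eq_sum_iff_of_le
      (fun i _ => Submodule.finrank_mono (hle i))).1 hsum
    have heq' : ∀ i, U i ⊔ Submodule.span K (v '' (A.filter (c₁ · = i) : Finset ι)) =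
        U i ⊔ Submodule.span K (v '' A) := fun i =>
      Submodule.eq_of_le_of_finrank_eq (hle i) (heq i (Finset.mem_univ i))
    refine ⟨fun e => if e ∈ A then c₁ e else c₂ e, fun i => ?_⟩
    have hsplit : E.filter (fun e => (if e ∈ A then c₁ e else c₂ e) = i) =
        A.filter (c₁ · = i) ∪ (E \ A).filter (c₂ · = i) := by
      ext e
      have := @hAE.1 e
      by_cases he : e ∈ A <;> simp [he, this]
    have hd : Disjoint (A.filter (c₁ · = i)) ((E \ A).filter (c₂ · = i)) :=
      Finset.disjoint_filter_filter Finset.disjoint_sdiff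
    rw [hsplit, Finset.card_union_of_disjoint hd, Finset.coe_union, Set.image_union,
      Submodule.span_union, ← sup_assoc, heq' i, hc₂ i, ← add_assoc, ← hc₁ i, heq' i]
  · push Not at ht
    obtain ⟨e, he⟩ := Finset.nonempty_iff_ne_empty.2 hE
    obtain ⟨j, hj⟩ : ∃ j, finrank K (U j) < finrank K ↥(U j ⊔ Submodule.span K {v e}) := by
      by_contra! hcon
      have h1 := h {e} (by simpa using he)
      have h2 := Finset.sum_le_sum fun i (_ : i ∈ Finset.univ) => hcon i
      rw [Finset.card_singleton, Finset.coe_singleton, Set.image_singleton] at h1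
      omega
    have hj' : finrank K ↥(U j ⊔ Submodule.span K {v e}) = finrank K (U j) + 1 :=
      le_antisymm (finrank_sup_span_singleton_le _ _) hj
    set U' := Function.update U j (U j ⊔ Submodule.span K {v e})
    have hUj : U' j = U j ⊔ Submodule.span K {v e} := Function.update_self ..
    have hUi : ∀ i, i ≠ j → U' i = U i := fun i hi => Function.update_of_ne hi ..
    clear_value U'
    have hUle : ∀ i, U i ≤ U' i := fun i => by
      by_cases hi : i = j
      · subst hi; simp [hUj]
      · simp [hUi i hi]
    have hUsum : ∑ i, finrank K (U' i) = ∑ i, finrank K (U i) + 1 := by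
      rw [← Finset.add_sum_erase _ _ (Finset.mem_univ j),
        ← Finset.add_sum_erase _ (fun i => finrank K (U i)) (Finset.mem_univ j)]
      have : ∑ i ∈ Finset.univ.erase j, finrank K (U' i) =
          ∑ i ∈ Finset.univ.erase j, finrank K (U i) :=
        Finset.sum_congr rfl fun i hi => by rw [hUi i (Finset.ne_of_mem_erase hi)]
      rw [this, hUj, hj']
      ring
    obtain ⟨c, hc⟩ := ih (E.erase e).card (Finset.card_erase_lt_of_mem he) (E.erase e) U'
      (fun A hA => by
        rcases A.eq_empty_or_nonempty with rfl | hne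
        · rw [Finset.card_empty, zero_add]
          exact Finset.sum_le_sum fun i _ => Submodule.finrank_mono le_sup_left
        · have h1 := ht A ((Finset.ssubset_iff_subset_ne.2 ⟨hA.trans (Finset.erase_subset _ _),
            fun hAE => Finset.notMem_erase e E (hA (hAE ▸ he))⟩)) hne
          have h2 : ∑ i, finrank K ↥(U i ⊔ Submodule.span K (v '' A)) ≤
              ∑ i, finrank K ↥(U' i ⊔ Submodule.span K (v '' A)) :=
            Finset.sum_le_sum fun i _ => Submodule.finrank_mono (sup_le_sup_right (hUle i) _)
          omega) rfl
    refine ⟨Function.update c e j, fun i => ?_⟩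
    by_cases hi : i = j
    · subst hi
      have hset : E.filter (Function.update c e i · = i) =
          insert e ((E.erase e).filter (c · = i)) := by
        ext x
        by_cases hx : x = e
        · subst hx; simp [he]
        · simp [hx]
      have := hc i
      rw [hUj] at this
      rw [hset, Finset.card_insert_of_notMem (by simp), Finset.coe_insert, Set.image_insert_eq,
        Submodule.span_insert, ← sup_assoc, this, hj']
      ring
    · have hset : E.filter (Function.update c e j · = i) = (E.erase e).filter (c · = i) := by
        ext x
        by_cases hx : x = e
        · subst hx; simp [Ne.symm hi]
        · simp [hx]
      have := hc i
      rw [hUi i hi] at this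
      rw [hset, this]

end Partition

section Forms

variable {σ : Type*}

/-- The restriction of a form of degree `n` to the span of three vectors is a ternary form. -/
theorem MvPolynomial.IsHomogeneous.exists_ternary_coeff {F : MvPolynomial σ ℂ} {n : ℕ}
    (hF : F.IsHomogeneous n) (u v w : σ → ℂ) :
    ∃ c : ℕ → ℕ → ℂ, ∀ x y z : ℂ, eval (x • u + y • v + z • w) F =
      ∑ i ∈ Finset.range (n + 1), ∑ j ∈ Finset.range (n + 1 - i),
        c i j * x ^ i * y ^ j * z ^ (n - i - j) := by
  classical
  set f : MvPolynomial (Fin 3) ℂ :=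
    MvPolynomial.aeval (fun k => C (u k) * X 0 + C (v k) * X 1 + C (w k) * X 2) F with hf
  have hfh : f.IsHomogeneous n := by
    have := hF.aeval (n := 1) (fun k => C (u k) * X 0 + C (v k) * X 1 + C (w k) * X 2 :
      σ → MvPolynomial (Fin 3) ℂ) (fun k => by
        refine IsHomogeneous.add (IsHomogeneous.add ?_ ?_) ?_ <;>
        · rw [← zero_add 1]
          exact (isHomogeneous_C _ _).mul (isHomogeneous_X _ _))
    rwa [one_mul] at this
  have heval : ∀ x y z : ℂ, eval (x • u + y • v + z • w) F = eval ![x, y, z] f := by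
    intro x y z
    rw [hf, ← coe_aeval_eq_eval, ← coe_aeval_eq_eval]
    simp only [RingHom.coe_coe]
    rw [← AlgHom.comp_apply, comp_aeval]
    congr 2
    funext k
    simp [mul_comm]
  refine ⟨fun i j => ∑ d ∈ f.support, if d 0 = i ∧ d 1 = j then f.coeff d else 0, fun x y z => ?_⟩
  rw [heval, eval_eq']
  simp only [Finset.sum_mul]
  rw [Finset.sum_congr rfl fun i _ => Finset.sum_comm, Finset.sum_comm]
  refine Finset.sum_congr rfl fun d hd => ?_
  have hdeg : d 0 + d 1 + d 2 = n := by
    have := hfh (mem_support_iff.1 hd)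
    rw [Finsupp.weight_apply, Finsupp.sum_fintype _ _ (by simp)] at this
    simpa [Fin.sum_univ_three] using this
  rw [Finset.sum_eq_single (d 0), Finset.sum_eq_single (d 1)]
  · have : n - d 0 - d 1 = d 2 := by omega
    simp [Fin.prod_univ_three, this, mul_assoc]
  · intro j _ hj
    simp [hj.symm]
  · intro h
    simp at h
    omega
  · intro i _ hi
    simp [hi.symm]
  · intro h
    simp at h
    omega

theorem MvPolynomial.hasDerivAt_eval_line [Fintype σ] (F : MvPolynomial σ ℂ) (p w : σ → ℂ) :
    HasDerivAt (fun t : ℂ => eval (p + t • w) F) (∑ i, w i * eval p (pderiv i F)) 0 := by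
  classical
  induction F using MvPolynomial.induction_on with
  | C a => simpa using hasDerivAt_const (0 : ℂ) a
  | add f g hf hg =>
    have := hf.add hg
    simp only [map_add, mul_add, Finset.sum_add_distrib]
    exact this
  | mul_X f k hf =>
    have hX : HasDerivAt (fun t : ℂ => p k + t * w k) (w k) 0 := by
      simpa using ((hasDerivAt_id (0 : ℂ)).mul_const (w k)).const_add (p k)
    have := hf.mul hX
    simp only [map_mul, eval_X, Pi.add_apply, Pi.smul_apply, smul_eq_mul]
    refine this.congr_deriv ?_
    simp only [Derivation.leibniz, pderiv_X, smul_eq_mul, map_add, map_mul, eval_X, mul_add,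
      Finset.sum_add_distrib, zero_smul, add_zero, zero_mul, Finset.sum_mul]
    rw [add_comm]
    congr 1
    · rw [Finset.sum_eq_single k]
      · simp [mul_comm]
      · intro j _ hj
        simp [hj.symm]
      · simp
    · exact Finset.sum_congr rfl fun i _ => by ring

/-- The linear coefficient of a polynomial restricted to a line through a critical point vanishes. -/
theorem MvPolynomial.linear_coeff_eq_zero [Fintype σ] {F : MvPolynomial σ ℂ} {p w : σ → ℂ}
    (hp : ∀ i, eval p (pderiv i F) = 0) {k₀ k₁ k₂ k₃ k₄ : ℂ}
    (h : ∀ t : ℂ, eval (p + t • w) F = k₀ + k₁ * t + k₂ * t ^ 2 + k₃ * t ^ 3 + k₄ * t ^ 4) :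
    k₁ = 0 := by
  have h1 := F.hasDerivAt_eval_line p w
  simp only [hp, mul_zero, Finset.sum_const_zero] at h1
  have h2 : HasDerivAt (fun t : ℂ => k₀ + k₁ * t + k₂ * t ^ 2 + k₃ * t ^ 3 + k₄ * t ^ 4) k₁ 0 := by
    have := (((((hasDerivAt_id (0 : ℂ)).const_mul k₁).const_add k₀).add
      ((hasDerivAt_pow 2 (0 : ℂ)).const_mul k₂)).add
      ((hasDerivAt_pow 3 (0 : ℂ)).const_mul k₃)).add ((hasDerivAt_pow 4 (0 : ℂ)).const_mul k₄)
    refine this.congr_deriv ?_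
    simp
  rw [← _root_.funext h] at h2
  exact h2.unique h1

end Forms

namespace QuarticThreefold

theorem P4.pair_independent {p q : P4} (h : p ≠ q) {a b : ℂ}
    (hab : a • p.rep + b • q.rep = 0) : a = 0 ∧ b = 0 :=
  LinearIndependent.pair_iff.1 (Projectivization.linearIndependent_pair_iff_ne.2 h) a b hab

theorem eval_eq_zero_of_pderiv {F : MvPolynomial (Fin 5) ℂ} (hF : F.IsHomogeneous 4)
    {v : Fin 5 → ℂ} (h : ∀ i, eval v (pderiv i F) = 0) : eval v F = 0 := by
  have := congrArg (eval v) hF.sum_X_mul_pderiv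
  simp only [map_sum, map_mul, h, mul_zero, Finset.sum_const_zero, map_nsmul] at this
  simpa using this.symm

theorem eval_smul_of_isHomogeneous {G : MvPolynomial (Fin 5) ℂ} {n : ℕ} (hG : G.IsHomogeneous n)
    (a : ℂ) (v : Fin 5 → ℂ) : eval (a • v) G = a ^ n * eval v G := by
  rw [eval_eq', eval_eq', Finset.mul_sum]
  refine Finset.sum_congr rfl fun d hd => ?_
  have hdeg : ∑ i, d i = n := by
    have := hG (mem_support_iff.1 hd)
    rw [Finsupp.weight_apply, Finsupp.sum_fintype _ _ (by simp)] at this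
    simpa using this
  simp only [Pi.smul_apply, smul_eq_mul, mul_pow, Finset.prod_mul_distrib,
    Finset.prod_pow_eq_pow_sum, hdeg]
  ring

theorem mk_mem_Sing {F : MvPolynomial (Fin 5) ℂ} (hF : F.IsHomogeneous 4)
    {v : Fin 5 → ℂ} (hv : v ≠ 0) (h : ∀ i, eval v (pderiv i F) = 0) :
    Projectivization.mk ℂ v hv ∈ Sing F := by
  have h' : ∀ i, eval (Projectivization.mk ℂ v hv).rep (pderiv i F) = 0 := by
    intro i
    obtain ⟨a, ha⟩ := Projectivization.exists_smul_eq_mk_rep ℂ v hv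
    rw [← ha, Units.smul_def, eval_smul_of_isHomogeneous hF.pderiv, h, mul_zero]
  exact ⟨eval_eq_zero_of_pderiv hF h', h'⟩

/-- A finite singular locus contains no injectively parametrized curve. -/
theorem not_infinite_family {F : MvPolynomial (Fin 5) ℂ} (hF : F.IsHomogeneous 4)
    (hfin : (Sing F).Finite) {A : Set ℂ} (hA : A.Infinite) (γ : ℂ → Fin 5 → ℂ)
    (h0 : ∀ s ∈ A, γ s ≠ 0) (h : ∀ s ∈ A, ∀ i, eval (γ s) (pderiv i F) = 0)
    (hinj : ∀ s ∈ A, ∀ t ∈ A, ∀ a : ℂ, a • γ t = γ s → s = t) : False := by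
  classical
  refine Set.infinite_of_injOn_mapsTo
    (f := fun s => if hs : s ∈ A then Projectivization.mk ℂ (γ s) (h0 s hs) else
      Projectivization.mk ℂ (1 : Fin 5 → ℂ) one_ne_zero) (t := Sing F) ?_ ?_ hA hfin
  · intro s hs t ht hst
    simp only [hs, ht, dif_pos] at hst
    obtain ⟨a, ha⟩ := (Projectivization.mk_eq_mk_iff' ℂ _ _ _ _).1 hst
    exact hinj s hs t ht a ha
  · intro s hs
    simp only [hs, dif_pos]
    exact mk_mem_Sing hF _ (h s hs)

theorem card_le_three_of_finrank_le_two {F : MvPolynomial (Fin 5) ℂ} (hF : F.IsHomogeneous 4)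
    (hfin : (Sing F).Finite) {T : Finset P4} (hT : ∀ p ∈ T, p ∈ Sing F)
    {U : Submodule ℂ (Fin 5 → ℂ)} (hU : finrank ℂ U ≤ 2) (hTU : ∀ p ∈ T, p.rep ∈ U) :
    T.card ≤ 3 := by
  classical
  by_contra! hcard
  obtain ⟨p, hp⟩ : T.Nonempty := Finset.card_pos.1 (by omega)
  have : 2 < (T.erase p).card := by rw [Finset.card_erase_of_mem hp]; omega
  obtain ⟨q, hq, r, hr, s, hs, hqr, hqs, hrs⟩ := Finset.two_lt_card.1 this
  rw [Finset.mem_erase] at hq hr hs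
  have hspan : U = Submodule.span ℂ {p.rep, q.rep} := by
    have hli : LinearIndependent ℂ ![p.rep, q.rep] :=
      Projectivization.linearIndependent_pair_iff_ne.2 hq.1.symm
    have h2 := finrank_span_eq_card hli
    rw [Matrix.range_cons, Matrix.range_cons, Matrix.range_empty, Set.union_empty,
      Set.singleton_union, Fintype.card_fin] at h2
    refine (Submodule.eq_of_le_of_finrank_le ?_ (by omega)).symm
    rw [Submodule.span_le]
    rintro x (rfl | rfl)
    · exact hTU p hp
    · exact hTU q hq.2
  obtain ⟨x₁, y₁, h₁⟩ := Submodule.mem_span_pair.1 (hspan ▸ hTU r hr.2)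
  obtain ⟨x₂, y₂, h₂⟩ := Submodule.mem_span_pair.1 (hspan ▸ hTU s hs.2)
  have hx₁ : x₁ ≠ 0 := by
    rintro rfl
    have := (P4.pair_independent hqr (a := y₁) (b := -1) (by rw [← h₁]; module)).2
    norm_num at this
  have hy₁ : y₁ ≠ 0 := by
    rintro rfl
    have := (P4.pair_independent hr.1.symm (a := x₁) (b := -1) (by rw [← h₁]; module)).2
    norm_num at this
  have hx₂ : x₂ ≠ 0 := by
    rintro rfl
    have := (P4.pair_independent hqs (a := y₂) (b := -1) (by rw [← h₂]; module)).2
    norm_num at this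
  have hy₂ : y₂ ≠ 0 := by
    rintro rfl
    have := (P4.pair_independent hs.1.symm (a := x₂) (b := -1) (by rw [← h₂]; module)).2
    norm_num at this
  have hdet : x₁ * y₂ - x₂ * y₁ ≠ 0 := by
    intro hdet
    refine hy₂ (P4.pair_independent hrs (a := y₂) (b := -y₁) ?_).1
    rw [← h₁, ← h₂]
    have : y₂ • (x₁ • p.rep + y₁ • q.rep) + -y₁ • (x₂ • p.rep + y₂ • q.rep) =
        (x₁ * y₂ - x₂ * y₁) • p.rep := by module
    rw [this, hdet, zero_smul]
  have key : ∀ i, ∀ x y : ℂ, eval (x • p.rep + y • q.rep) (pderiv i F) = 0 := by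
    intro i
    obtain ⟨c, hc⟩ := (hF.pderiv (i := i)).exists_ternary_coeff p.rep q.rep 0
    have hc' : ∀ x y : ℂ, eval (x • p.rep + y • q.rep) (pderiv i F) =
        c 0 3 * y ^ 3 + c 1 2 * x * y ^ 2 + c 2 1 * x ^ 2 * y + c 3 0 * x ^ 3 := by
      intro x y
      have := hc x y 0
      simp only [smul_zero, add_zero] at this
      rw [this]
      simp [Finset.sum_range_succ]
    have e₁ : c 3 0 = 0 := by
      have := hc' 1 0
      simpa [(hT p hp).2 i] using this.symm
    have e₂ : c 0 3 = 0 := by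
      have := hc' 0 1
      simpa [(hT q hq.2).2 i] using this.symm
    have e₃ : c 1 2 * y₁ + c 2 1 * x₁ = 0 := by
      have := hc' x₁ y₁
      rw [h₁, (hT r hr.2).2 i, e₁, e₂] at this
      refine (mul_eq_zero.1 (?_ : (x₁ * y₁) * (c 1 2 * y₁ + c 2 1 * x₁) = 0)).resolve_left
        (mul_ne_zero hx₁ hy₁)
      linear_combination -this
    have e₄ : c 1 2 * y₂ + c 2 1 * x₂ = 0 := by
      have := hc' x₂ y₂
      rw [h₂, (hT s hs.2).2 i, e₁, e₂] at this
      refine (mul_eq_zero.1 (?_ : (x₂ * y₂) * (c 1 2 * y₂ + c 2 1 * x₂) = 0)).resolve_left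
        (mul_ne_zero hx₂ hy₂)
      linear_combination -this
    have e₅ : c 1 2 = 0 := (mul_eq_zero.1 (by linear_combination x₁ * e₄ - x₂ * e₃ :
      (x₁ * y₂ - x₂ * y₁) * c 1 2 = 0)).resolve_left hdet
    have e₆ : c 2 1 = 0 := (mul_eq_zero.1 (by linear_combination y₂ * e₃ - y₁ * e₄ :
      (x₁ * y₂ - x₂ * y₁) * c 2 1 = 0)).resolve_left hdet
    intro x y
    rw [hc', e₁, e₂, e₅, e₆]
    ring
  refine not_infinite_family hF hfin Set.infinite_univ (fun s => (1 : ℂ) • p.rep + s • q.rep) ?_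
    (fun s _ i => key i 1 s) ?_
  · intro s _ h
    exact one_ne_zero (P4.pair_independent hq.1.symm h).1
  · intro s _ t _ a h
    have := P4.pair_independent hq.1.symm (a := a - 1) (b := a * t - s) (by
      rw [← sub_eq_zero] at h
      rw [← h]
      module)
    linear_combination t * this.1 - this.2
end QuarticThreefold

namespace QuarticThreefold

/-- The quartic form `(x y z)² q(1/x, 1/y, 1/z)`, where `q` is the quadratic form with the given
coefficients; these are the ternary quartic forms that are singular at the coordinate points. -/
def cremonaQuartic (A B C D E H x y z : ℂ) : ℂ :=
  A * (y * z) ^ 2 + B * (x * z) ^ 2 + C * (x * y) ^ 2 + D * (x * z) * (x * y) +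
    E * (y * z) * (x * y) + H * (y * z) * (x * z)

/-- Two independent vectors in the kernel of a symmetric `3 × 3` matrix force it to have rank at
most one. -/
theorem exists_rank_one_of_kernel {A B C D E H p₁ p₂ p₃ q₁ q₂ q₃ l₁ l₂ l₃ : ℂ}
    (hl₁ : l₁ = p₂ * q₃ - p₃ * q₂) (hl₂ : l₂ = p₃ * q₁ - p₁ * q₃) (hl₃ : l₃ = p₁ * q₂ - p₂ * q₁)
    (hl : ¬(l₁ = 0 ∧ l₂ = 0 ∧ l₃ = 0))
    (hp₁ : 2 * A * p₁ + H * p₂ + E * p₃ = 0) (hp₂ : H * p₁ + 2 * B * p₂ + D * p₃ = 0)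
    (hp₃ : E * p₁ + D * p₂ + 2 * C * p₃ = 0)
    (hq₁ : 2 * A * q₁ + H * q₂ + E * q₃ = 0) (hq₂ : H * q₁ + 2 * B * q₂ + D * q₃ = 0)
    (hq₃ : E * q₁ + D * q₂ + 2 * C * q₃ = 0) :
    ∃ k : ℂ, 2 * A = k * l₁ ^ 2 ∧ 2 * B = k * l₂ ^ 2 ∧ 2 * C = k * l₃ ^ 2 ∧
      H = k * (l₁ * l₂) ∧ E = k * (l₁ * l₃) ∧ D = k * (l₂ * l₃) := by
  have cross : ∀ r₁ r₂ r₃ : ℂ, r₁ * p₁ + r₂ * p₂ + r₃ * p₃ = 0 →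
      r₁ * q₁ + r₂ * q₂ + r₃ * q₃ = 0 →
      r₂ * l₃ = r₃ * l₂ ∧ r₃ * l₁ = r₁ * l₃ ∧ r₁ * l₂ = r₂ * l₁ := by
    intro r₁ r₂ r₃ h h'
    subst hl₁ hl₂ hl₃
    refine ⟨?_, ?_, ?_⟩
    · linear_combination p₁ * h' - q₁ * h
    · linear_combination p₂ * h' - q₂ * h
    · linear_combination p₃ * h' - q₃ * h
  obtain ⟨a₁, a₂, a₃⟩ := cross _ _ _ hp₁ hq₁
  obtain ⟨b₁, b₂, b₃⟩ := cross _ _ _ hp₂ hq₂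
  obtain ⟨c₁, c₂, c₃⟩ := cross _ _ _ hp₃ hq₃
  have conclude : ∀ l K M N : ℂ, l ≠ 0 → M * l ^ 2 = K * N → M = K / l ^ 2 * N := by
    intro l K M N h h'
    rw [div_mul_eq_mul_div, eq_div_iff (pow_ne_zero 2 h), h']
  by_cases h₁ : l₁ = 0
  · by_cases h₂ : l₂ = 0
    · have h₃ : l₃ ≠ 0 := fun h₃ => hl ⟨h₁, h₂, h₃⟩
      refine ⟨2 * C / l₃ ^ 2, ?_, ?_, ?_, ?_, ?_, ?_⟩ <;> refine conclude _ _ _ _ h₃ ?_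
      · linear_combination -l₃ * a₂ - l₁ * c₂
      · linear_combination l₃ * b₁ + l₂ * c₁
      · ring
      · linear_combination l₃ * a₁ - l₂ * c₂
      · linear_combination -l₃ * c₂
      · linear_combination l₃ * c₁
    · refine ⟨2 * B / l₂ ^ 2, ?_, ?_, ?_, ?_, ?_, ?_⟩ <;> refine conclude _ _ _ _ h₂ ?_
      · linear_combination l₂ * a₃ + l₁ * b₃
      · ring
      · linear_combination -l₂ * c₁ - l₃ * b₁
      · linear_combination l₂ * b₃
      · linear_combination l₂ * c₃ - l₁ * b₁
      · linear_combination -l₂ * b₁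
  · refine ⟨2 * A / l₁ ^ 2, ?_, ?_, ?_, ?_, ?_, ?_⟩ <;> refine conclude _ _ _ _ h₁ ?_
    · ring
    · linear_combination -l₁ * b₃ - l₂ * a₃
    · linear_combination l₁ * c₂ + l₃ * a₂
    · linear_combination -l₁ * a₃
    · linear_combination l₁ * a₂
    · linear_combination l₁ * b₂ - l₃ * a₃

section

variable {F : MvPolynomial (Fin 5) ℂ} {T : Finset P4}

open Classical in
theorem card_filter_linear_le_three (hF : F.IsHomogeneous 4) (hfin : (Sing F).Finite)
    (hT : ∀ p ∈ T, p ∈ Sing F) {u v w : Fin 5 → ℂ} {x y z : P4 → ℂ}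
    (hrep : ∀ p ∈ T, p.rep = x p • u + y p • v + z p • w) (a b c : ℂ)
    (h : ¬(a = 0 ∧ b = 0 ∧ c = 0)) :
    (T.filter fun p => a * x p + b * y p + c * z p = 0).card ≤ 3 := by
  let φ : (Fin 3 → ℂ) →ₗ[ℂ] ℂ := a • LinearMap.proj 0 + b • LinearMap.proj 1 + c • LinearMap.proj 2
  have hφ : ∀ s : Fin 3 → ℂ, φ s = a * s 0 + b * s 1 + c * s 2 := fun s => by simp [φ]
  have hφ0 : φ ≠ 0 := by
    intro h0
    refine h ⟨?_, ?_, ?_⟩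
    · simpa [hφ] using congrArg (fun ψ => ψ ![1, 0, 0]) h0
    · simpa [hφ] using congrArg (fun ψ => ψ ![0, 1, 0]) h0
    · simpa [hφ] using congrArg (fun ψ => ψ ![0, 0, 1]) h0
  have hker : finrank ℂ (LinearMap.ker φ) ≤ 2 := by
    have := Module.Dual.finrank_ker_add_one_of_ne_zero hφ0
    rw [finrank_fin_fun] at this
    omega
  let e := Fintype.linearCombination ℂ ![u, v, w]
  refine card_le_three_of_finrank_le_two hF hfin (U := (LinearMap.ker φ).map e)
    (fun p hp => hT p (Finset.mem_of_mem_filter p hp))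
    ((Submodule.finrank_map_le _ _).trans hker) fun p hp => ?_
  rw [Finset.mem_filter] at hp
  refine ⟨![x p, y p, z p], by simpa [hφ] using hp.2, ?_⟩
  rw [hrep p hp.1]
  simp [e, Fintype.linearCombination_apply, Fin.sum_univ_three]

/-- If the singular locus of a quartic is finite, then at most seven of its points lie on a smooth
conic `a y z + b x z + c x y = 0`. -/
theorem card_le_seven_of_conic (hF : F.IsHomogeneous 4) (hfin : (Sing F).Finite)
    (hT : ∀ p ∈ T, p ∈ Sing F) {u w : Fin 5 → ℂ} {q : P4} {x y z : P4 → ℂ}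
    (hli : ∀ a b c : ℂ, a • u + b • q.rep + c • w = 0 → a = 0 ∧ b = 0 ∧ c = 0)
    (hrep : ∀ p ∈ T, p.rep = x p • u + y p • q.rep + z p • w) {a b c : ℂ}
    (ha : a ≠ 0) (hb : b ≠ 0) (hc : c ≠ 0)
    (hconic : ∀ p ∈ T, a * (y p * z p) + b * (x p * z p) + c * (x p * y p) = 0) :
    T.card ≤ 7 := by
  classical
  by_contra! hcard
  let γ : ℂ → Fin 5 → ℂ := fun s =>
    (-a * (s + 1)) • u + (-b * (s * (s + 1))) • q.rep + (c * s) • w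
  have hγ : ∀ p ∈ T.erase q, ∃ s k : ℂ, k ≠ 0 ∧ γ s = k • p.rep := by
    intro p hp
    rw [Finset.mem_erase] at hp
    have hpc := hconic p hp.2
    have hpr := hrep p hp.2
    by_cases hx : x p = 0
    · have hz : z p ≠ 0 := by
        intro hz
        have := P4.pair_independent hp.1 (a := 1) (b := -y p) (by rw [hpr, hx, hz]; module)
        exact one_ne_zero this.1
      have hy : y p = 0 := by
        have : a * z p * y p = 0 := by rw [hx] at hpc; linear_combination hpc
        exact (mul_eq_zero.1 this).resolve_left (mul_ne_zero ha hz)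
      refine ⟨-1, -c / z p, div_ne_zero (neg_ne_zero.2 hc) hz, ?_⟩
      simp only [γ]
      rw [hpr, hx, hy]
      match_scalars <;> field_simp <;> ring
    · have hs : a * y p + b * x p ≠ 0 := by
        intro hs
        have : c * x p * y p = 0 := by linear_combination hpc - z p * hs
        have hy := (mul_eq_zero.1 this).resolve_left (mul_ne_zero hc hx)
        rw [hy] at hs
        exact mul_ne_zero hb hx (by linear_combination hs)
      refine ⟨a * y p / (b * x p), -a * (a * y p + b * x p) / (b * x p ^ 2),
        div_ne_zero (mul_ne_zero (neg_ne_zero.2 ha) hs) (mul_ne_zero hb (pow_ne_zero 2 hx)), ?_⟩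
      simp only [γ]
      rw [hpr]
      match_scalars
      · field_simp
      · field_simp
      · field_simp
        linear_combination hpc
  choose! s k hk hsk using hγ
  have hinj : Set.InjOn s (T.erase q) := by
    intro p hp p' hp' h
    by_contra hne
    refine hk p hp (P4.pair_independent hne (a := k p) (b := -k p') ?_).1
    rw [neg_smul, ← hsk p hp, ← hsk p' hp', h, add_neg_cancel]
  have hvanish : ∀ i t, eval (γ t) (pderiv i F) = 0 := by
    intro i t
    let P : Polynomial ℂ := aeval (fun j =>
      Polynomial.C (-a * u j) * (Polynomial.X + 1) +
        Polynomial.C (-b * q.rep j) * (Polynomial.X * (Polynomial.X + 1)) +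
        Polynomial.C (c * w j) * Polynomial.X) (pderiv i F)
    have hdeg : P.natDegree ≤ 3 * 2 := by
      refine aeval_natDegree_le (m := 3) _ hF.pderiv.totalDegree_le _ fun j => ?_
      compute_degree
    have heval : ∀ t, P.eval t = eval (γ t) (pderiv i F) := by
      intro t
      rw [← Polynomial.coe_aeval_eq_eval, ← coe_aeval_eq_eval]
      simp only [P, RingHom.coe_coe]
      rw [← AlgHom.comp_apply, comp_aeval]
      congr 2
      funext j
      simp [γ]
      ring
    have hP : P = 0 := by
      refine Polynomial.eq_zero_of_natDegree_lt_card_of_eval_eq_zero' P ((T.erase q).image s) ?_ ?_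
      · intro t ht
        obtain ⟨p, hp, rfl⟩ := Finset.mem_image.1 ht
        rw [heval, hsk p hp, eval_smul_of_isHomogeneous hF.pderiv,
          (hT p (Finset.mem_of_mem_erase hp)).2 i, mul_zero]
      · rw [Finset.card_image_of_injOn hinj]
        have := Finset.pred_card_le_card_erase (s := T) (a := q)
        omega
    rw [← heval, hP, Polynomial.eval_zero]
  have hA : ({-1}ᶜ : Set ℂ).Infinite := (Set.finite_singleton _).infinite_compl
  have hne : ∀ t ∈ ({-1}ᶜ : Set ℂ), t + 1 ≠ 0 := fun t ht h => ht (eq_neg_of_add_eq_zero_left h)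
  refine not_infinite_family hF hfin hA γ (fun t ht h => ?_) (fun t _ i => hvanish i t) ?_
  · exact mul_ne_zero (neg_ne_zero.2 ha) (hne t ht) (hli _ _ _ h).1
  · intro s hs t _ d h
    rw [← sub_eq_zero] at h
    obtain ⟨h₁, h₂, -⟩ := hli (a * (s + 1 - d * (t + 1))) (b * (s * (s + 1) - d * (t * (t + 1))))
      (c * (d * t - s)) (by rw [← h]; simp only [γ]; module)
    have h₁ := (mul_eq_zero.1 h₁).resolve_left ha
    have h₂ := (mul_eq_zero.1 h₂).resolve_left hb
    have : (s + 1) * (s - t) = 0 := by linear_combination h₂ - t * h₁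
    exact sub_eq_zero.1 ((mul_eq_zero.1 this).resolve_left (hne s hs))

end

end QuarticThreefold

namespace QuarticThreefold

variable {F : MvPolynomial (Fin 5) ℂ}

theorem exists_cremonaQuartic (hF : F.IsHomogeneous 4) {u v w : Fin 5 → ℂ}
    (hu : ∀ i, eval u (pderiv i F) = 0) (hv : ∀ i, eval v (pderiv i F) = 0)
    (hw : ∀ i, eval w (pderiv i F) = 0) :
    ∃ A B C D E H : ℂ, ∀ x y z : ℂ,
      eval (x • u + y • v + z • w) F = cremonaQuartic A B C D E H x y z := by
  obtain ⟨c, hc⟩ := hF.exists_ternary_coeff u v w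
  simp only [Finset.sum_range_succ, Finset.sum_range_zero, zero_add, Nat.reduceAdd, Nat.reduceSub,
    pow_zero, mul_one, pow_one, Nat.sub_zero, Nat.sub_self] at hc
  have e40 : c 4 0 = 0 := by
    have := hc 1 0 0
    simpa [eval_eq_zero_of_pderiv hF hu] using this.symm
  have e04 : c 0 4 = 0 := by
    have := hc 0 1 0
    simpa [eval_eq_zero_of_pderiv hF hv] using this.symm
  have e00 : c 0 0 = 0 := by
    have := hc 0 0 1
    simpa [eval_eq_zero_of_pderiv hF hw] using this.symm
  have e31 : c 3 1 = 0 := linear_coeff_eq_zero (w := v) hu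
    (k₀ := c 4 0) (k₂ := c 2 2) (k₃ := c 1 3) (k₄ := c 0 4) fun t => by
      have := hc 1 t 0
      rw [one_smul, zero_smul, add_zero] at this
      rw [this]
      ring
  have e30 : c 3 0 = 0 := linear_coeff_eq_zero (w := w) hu
    (k₀ := c 4 0) (k₂ := c 2 0) (k₃ := c 1 0) (k₄ := c 0 0) fun t => by
      have := hc 1 0 t
      rw [one_smul, zero_smul, add_zero] at this
      rw [this]
      ring
  have e13 : c 1 3 = 0 := linear_coeff_eq_zero (w := u) hv
    (k₀ := c 0 4) (k₂ := c 2 2) (k₃ := c 3 1) (k₄ := c 4 0) fun t => by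
      have := hc t 1 0
      rw [one_smul, zero_smul, add_zero, add_comm] at this
      rw [this]
      ring
  have e03 : c 0 3 = 0 := linear_coeff_eq_zero (w := w) hv
    (k₀ := c 0 4) (k₂ := c 0 2) (k₃ := c 0 1) (k₄ := c 0 0) fun t => by
      have := hc 0 1 t
      rw [one_smul, zero_smul, zero_add] at this
      rw [this]
      ring
  have e10 : c 1 0 = 0 := linear_coeff_eq_zero (w := u) hw
    (k₀ := c 0 0) (k₂ := c 2 0) (k₃ := c 3 0) (k₄ := c 4 0) fun t => by
      have := hc t 0 1
      rw [one_smul, zero_smul, add_zero, add_comm] at this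
      rw [this]
      ring
  have e01 : c 0 1 = 0 := linear_coeff_eq_zero (w := v) hw
    (k₀ := c 0 0) (k₂ := c 0 2) (k₃ := c 0 3) (k₄ := c 0 4) fun t => by
      have := hc 0 t 1
      rw [one_smul, zero_smul, zero_add, add_comm] at this
      rw [this]
      ring
  refine ⟨c 0 2, c 2 0, c 2 2, c 2 1, c 1 2, c 1 1, fun x y z => ?_⟩
  rw [hc, e40, e04, e00, e31, e30, e13, e03, e10, e01, cremonaQuartic]
  ring

/-- The quadratic Cremona transformation takes singular points off the coordinate triangle to
singular points of a conic. -/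
theorem kernel_of_cremonaQuartic {u v w : Fin 5 → ℂ} {A B C D E H : ℂ} (hF : F.IsHomogeneous 4)
    (hform : ∀ x y z : ℂ, eval (x • u + y • v + z • w) F = cremonaQuartic A B C D E H x y z)
    {x y z : ℂ} (hx : x ≠ 0) (hy : y ≠ 0) (hz : z ≠ 0)
    (h : ∀ i, eval (x • u + y • v + z • w) (pderiv i F) = 0) :
    2 * A * (y * z) + H * (x * z) + E * (x * y) = 0 ∧
      H * (y * z) + 2 * B * (x * z) + D * (x * y) = 0 ∧
      E * (y * z) + D * (x * z) + 2 * C * (x * y) = 0 := by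
  have h0 : cremonaQuartic A B C D E H x y z = 0 := by
    rw [← hform]
    exact eval_eq_zero_of_pderiv hF h
  rw [cremonaQuartic] at h0
  have hu : 2 * B * (x * z ^ 2) + 2 * C * (x * y ^ 2) + 2 * D * (x * y * z) + E * (y ^ 2 * z) +
      H * (y * z ^ 2) = 0 :=
    linear_coeff_eq_zero (w := u) h (k₀ := 0)
      (k₂ := B * z ^ 2 + C * y ^ 2 + D * y * z) (k₃ := 0) (k₄ := 0) fun t => by
        have : x • u + y • v + z • w + t • u = (x + t) • u + y • v + z • w := by module
        rw [this, hform, cremonaQuartic]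
        linear_combination h0
  have hv : 2 * A * (y * z ^ 2) + 2 * C * (x ^ 2 * y) + D * (x ^ 2 * z) + 2 * E * (x * y * z) +
      H * (x * z ^ 2) = 0 :=
    linear_coeff_eq_zero (w := v) h (k₀ := 0)
      (k₂ := A * z ^ 2 + C * x ^ 2 + E * x * z) (k₃ := 0) (k₄ := 0) fun t => by
        have : x • u + y • v + z • w + t • v = x • u + (y + t) • v + z • w := by module
        rw [this, hform, cremonaQuartic]
        linear_combination h0
  have hw : 2 * A * (y ^ 2 * z) + 2 * B * (x ^ 2 * z) + D * (x ^ 2 * y) + E * (x * y ^ 2) +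
      2 * H * (x * y * z) = 0 :=
    linear_coeff_eq_zero (w := w) h (k₀ := 0)
      (k₂ := A * y ^ 2 + B * x ^ 2 + H * x * y) (k₃ := 0) (k₄ := 0) fun t => by
        have : x • u + y • v + z • w + t • w = x • u + y • v + (z + t) • w := by module
        rw [this, hform, cremonaQuartic]
        linear_combination h0
  refine ⟨?_, ?_, ?_⟩
  · refine (mul_eq_zero.1 (?_ : y * z * _ = 0)).resolve_left (mul_ne_zero hy hz)
    linear_combination 2 * h0 - x * hu
  · refine (mul_eq_zero.1 (?_ : x * z * _ = 0)).resolve_left (mul_ne_zero hx hz)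
    linear_combination 2 * h0 - y * hv
  · refine (mul_eq_zero.1 (?_ : x * y * _ = 0)).resolve_left (mul_ne_zero hx hy)
    linear_combination 2 * h0 - z * hw

theorem card_le_seven_of_finrank_eq_three (hF : F.IsHomogeneous 4) (hfin : (Sing F).Finite)
    {T : Finset P4} (hT : ∀ p ∈ T, p ∈ Sing F) {W : Submodule ℂ (Fin 5 → ℂ)}
    (hW : finrank ℂ W = 3) (hTW : ∀ p ∈ T, p.rep ∈ W) (hWF : ∃ q ∈ W, eval q F ≠ 0) :
    T.card ≤ 7 := by
  classical
  by_contra! hcard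
  obtain ⟨p₁, hp₁, p₂, hp₂, h₁₂⟩ := Finset.one_lt_card.1 (by omega : 1 < T.card)
  obtain ⟨p₃, hp₃, h₃⟩ : ∃ p ∈ T, p.rep ∉ Submodule.span ℂ {p₁.rep, p₂.rep} := by
    by_contra! hcon
    have := card_le_three_of_finrank_le_two hF hfin hT
      ((finrank_span_le_card _).trans (by
        rw [Set.toFinset_card, Fintype.card_eq_nat_card]
        exact (Set.ncard_insert_le _ _).trans (by rw [Set.ncard_singleton]))) hcon
    omega
  have hli : ∀ a b c : ℂ, a • p₁.rep + b • p₂.rep + c • p₃.rep = 0 → a = 0 ∧ b = 0 ∧ c = 0 := by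
    intro a b c h
    have hc : c = 0 := by
      by_contra hc
      refine h₃ (Submodule.mem_span_pair.2 ⟨-a / c, -b / c, ?_⟩)
      have h' : c • (((-a / c) • p₁.rep + (-b / c) • p₂.rep) - p₃.rep) = 0 := by
        rw [← neg_eq_zero, ← h]
        match_scalars <;> field_simp
      exact sub_eq_zero.1 ((smul_eq_zero.1 h').resolve_left hc)
    rw [hc, zero_smul, add_zero] at h
    exact ⟨(P4.pair_independent h₁₂ h).1, (P4.pair_independent h₁₂ h).2, hc⟩
  have hspan : ∀ q ∈ W, ∃ x y z : ℂ, q = x • p₁.rep + y • p₂.rep + z • p₃.rep := by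
    have hLI : LinearIndependent ℂ ![p₁.rep, p₂.rep, p₃.rep] := by
      rw [Fintype.linearIndependent_iff]
      intro g hg
      rw [Fin.sum_univ_three] at hg
      obtain ⟨h0, h1, h2⟩ := hli _ _ _ hg
      intro i
      fin_cases i
      exacts [h0, h1, h2]
    have hle : Submodule.span ℂ (Set.range ![p₁.rep, p₂.rep, p₃.rep]) ≤ W := by
      rw [Submodule.span_le]
      rintro _ ⟨i, rfl⟩
      fin_cases i
      exacts [hTW _ hp₁, hTW _ hp₂, hTW _ hp₃]
    have heq := Submodule.eq_of_le_of_finrank_eq hle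
      (by rw [finrank_span_eq_card hLI, Fintype.card_fin, hW])
    intro q hq
    rw [← heq, Submodule.mem_span_range_iff_exists_fun] at hq
    obtain ⟨c, hc⟩ := hq
    exact ⟨c 0, c 1, c 2, by rw [← hc, Fin.sum_univ_three]; rfl⟩
  choose! x y z hrep using fun p : P4 => fun hp : p ∈ T => hspan p.rep (hTW p hp)
  have hline : ∀ a b c : ℂ, ¬(a = 0 ∧ b = 0 ∧ c = 0) →
      (T.filter fun p => a * x p + b * y p + c * z p = 0).card ≤ 3 := fun a b c =>
    card_filter_linear_le_three hF hfin hT hrep a b c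
  have htwo : ∀ a b c a' b' c' : ℂ, ¬(a = 0 ∧ b = 0 ∧ c = 0) → ¬(a' = 0 ∧ b' = 0 ∧ c' = 0) →
      ¬∀ p ∈ T, (a * x p + b * y p + c * z p) * (a' * x p + b' * y p + c' * z p) = 0 := by
    intro a b c a' b' c' h h' hall
    have hsub : T ⊆ (T.filter fun p => a * x p + b * y p + c * z p = 0) ∪
        (T.filter fun p => a' * x p + b' * y p + c' * z p = 0) := by
      intro p hp
      simpa [hp] using hall p hp
    have h₁ := Finset.card_le_card hsub
    have h₂ := Finset.card_union_le (T.filter fun p => a * x p + b * y p + c * z p = 0)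
      (T.filter fun p => a' * x p + b' * y p + c' * z p = 0)
    have h₃ := hline a b c h
    have h₄ := hline a' b' c' h'
    omega
  obtain ⟨A, B, C, D, E, H, hform⟩ :=
    exists_cremonaQuartic hF (hT p₁ hp₁).2 (hT p₂ hp₂).2 (hT p₃ hp₃).2
  have coord : ∀ p ∈ T, ∀ a b c : ℂ, p.rep = a • p₁.rep + b • p₂.rep + c • p₃.rep →
      x p = a ∧ y p = b ∧ z p = c := by
    intro p hp a b c h
    obtain ⟨ha, hb, hc⟩ := hli (x p - a) (y p - b) (z p - c) (by
      have := (hrep p hp).symm.trans h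
      rw [← sub_eq_zero] at this
      rw [← this]
      module)
    exact ⟨sub_eq_zero.1 ha, sub_eq_zero.1 hb, sub_eq_zero.1 hc⟩
  obtain ⟨x₁, y₁, z₁⟩ := coord p₁ hp₁ 1 0 0 (by module)
  obtain ⟨x₂, y₂, z₂⟩ := coord p₂ hp₂ 0 1 0 (by module)
  obtain ⟨x₃, y₃, z₃⟩ := coord p₃ hp₃ 0 0 1 (by module)
  have h₁₃ : p₁ ≠ p₃ := by
    rintro rfl
    exact one_ne_zero (x₁.symm.trans x₃)
  have h₂₃ : p₂ ≠ p₃ := by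
    rintro rfl
    exact one_ne_zero (y₂.symm.trans y₃)
  obtain ⟨q₁, hq₁, q₂, hq₂, hq₁₂⟩ : ∃ q₁ ∈ T.filter (fun p => x p ≠ 0 ∧ y p ≠ 0 ∧ z p ≠ 0),
      ∃ q₂ ∈ T.filter (fun p => x p ≠ 0 ∧ y p ≠ 0 ∧ z p ≠ 0), q₁ ≠ q₂ := by
    rw [← Finset.one_lt_card]
    have hX : ((T.filter fun p => x p = 0) \ {p₂, p₃}).card ≤ 1 := by
      have := hline 1 0 0 (by simp)
      simp only [one_mul, zero_mul, add_zero] at this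
      rw [Finset.card_sdiff_of_subset (by
        intro p hp
        rcases Finset.mem_insert.1 hp with rfl | hp
        · simp [hp₂, x₂]
        · rw [Finset.mem_singleton.1 hp]; simp [hp₃, x₃]), Finset.card_pair h₂₃]
      omega
    have hY : ((T.filter fun p => y p = 0) \ {p₁, p₃}).card ≤ 1 := by
      have := hline 0 1 0 (by simp)
      simp only [one_mul, zero_mul, add_zero, zero_add] at this
      rw [Finset.card_sdiff_of_subset (by
        intro p hp
        rcases Finset.mem_insert.1 hp with rfl | hp
        · simp [hp₁, y₁]
        · rw [Finset.mem_singleton.1 hp]; simp [hp₃, y₃]), Finset.card_pair h₁₃]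
      omega
    have hZ : ((T.filter fun p => z p = 0) \ {p₁, p₂}).card ≤ 1 := by
      have := hline 0 0 1 (by simp)
      simp only [one_mul, zero_mul, zero_add] at this
      rw [Finset.card_sdiff_of_subset (by
        intro p hp
        rcases Finset.mem_insert.1 hp with rfl | hp
        · simp [hp₁, z₁]
        · rw [Finset.mem_singleton.1 hp]; simp [hp₂, z₂]), Finset.card_pair h₁₂]
      omega
    have hsub : T ⊆ ((T.filter (fun p => x p ≠ 0 ∧ y p ≠ 0 ∧ z p ≠ 0) ∪ {p₁, p₂, p₃}) ∪
        ((T.filter fun p => x p = 0) \ {p₂, p₃})) ∪ (((T.filter fun p => y p = 0) \ {p₁, p₃}) ∪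
        ((T.filter fun p => z p = 0) \ {p₁, p₂})) := by
      intro p hp
      simp only [Finset.mem_union, Finset.mem_filter, Finset.mem_sdiff, Finset.mem_insert,
        Finset.mem_singleton]
      tauto
    have c0 := Finset.card_le_card hsub
    have c1 := (Finset.card_union_le _ _).trans (add_le_add
      ((Finset.card_union_le ((T.filter (fun p => x p ≠ 0 ∧ y p ≠ 0 ∧ z p ≠ 0) ∪ {p₁, p₂, p₃}))
        ((T.filter fun p => x p = 0) \ {p₂, p₃})).trans (add_le_add_left
        (Finset.card_union_le _ _) _)) (Finset.card_union_le ((T.filter fun p => y p = 0) \ {p₁, p₃})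
        ((T.filter fun p => z p = 0) \ {p₁, p₂})))
    have c2 := Finset.card_le_three (a := p₁) (b := p₂) (c := p₃)
    omega
  rw [Finset.mem_filter] at hq₁ hq₂
  obtain ⟨hq₁T, hx₁, hy₁, hz₁⟩ := hq₁
  obtain ⟨hq₂T, hx₂, hy₂, hz₂⟩ := hq₂
  obtain ⟨k₁, k₂, k₃⟩ := kernel_of_cremonaQuartic hF hform hx₁ hy₁ hz₁
    (hrep q₁ hq₁T ▸ (hT q₁ hq₁T).2)
  obtain ⟨m₁, m₂, m₃⟩ := kernel_of_cremonaQuartic hF hform hx₂ hy₂ hz₂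
    (hrep q₂ hq₂T ▸ (hT q₂ hq₂T).2)
  obtain ⟨a, ha⟩ : ∃ a, a = x q₁ * z q₁ * (x q₂ * y q₂) - x q₁ * y q₁ * (x q₂ * z q₂) := ⟨_, rfl⟩
  obtain ⟨b, hb⟩ : ∃ b, b = x q₁ * y q₁ * (y q₂ * z q₂) - y q₁ * z q₁ * (x q₂ * y q₂) := ⟨_, rfl⟩
  obtain ⟨c, hc⟩ : ∃ c, c = y q₁ * z q₁ * (x q₂ * z q₂) - x q₁ * z q₁ * (y q₂ * z q₂) := ⟨_, rfl⟩
  have habc : ¬(a = 0 ∧ b = 0 ∧ c = 0) := by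
    rintro ⟨-, rfl, rfl⟩
    have e₁ : x q₁ * z q₂ - z q₁ * x q₂ = 0 :=
      (mul_eq_zero.1 (by linear_combination -hb : (y q₁ * y q₂) * _ = 0)).resolve_left
        (mul_ne_zero hy₁ hy₂)
    have e₂ : y q₁ * x q₂ - x q₁ * y q₂ = 0 :=
      (mul_eq_zero.1 (by linear_combination -hc : (z q₁ * z q₂) * _ = 0)).resolve_left
        (mul_ne_zero hz₁ hz₂)
    refine hx₂ (P4.pair_independent hq₁₂ (a := x q₂) (b := -x q₁) ?_).1
    rw [hrep q₁ hq₁T, hrep q₂ hq₂T]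
    have : x q₂ • (x q₁ • p₁.rep + y q₁ • p₂.rep + z q₁ • p₃.rep) +
        -x q₁ • (x q₂ • p₁.rep + y q₂ • p₂.rep + z q₂ • p₃.rep) =
        (y q₁ * x q₂ - x q₁ * y q₂) • p₂.rep - (x q₁ * z q₂ - z q₁ * x q₂) • p₃.rep := by module
    rw [this, e₁, e₂, zero_smul, zero_smul, sub_zero]
  obtain ⟨k, eA, eB, eC, eH, eE, eD⟩ :=
    exists_rank_one_of_kernel ha hb hc habc k₁ k₂ k₃ m₁ m₂ m₃
  have hsq : ∀ x y z : ℂ, 2 * cremonaQuartic A B C D E H x y z =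
      k * (a * (y * z) + b * (x * z) + c * (x * y)) ^ 2 := by
    intro x y z
    rw [cremonaQuartic, eH, eE, eD]
    linear_combination (y * z) ^ 2 * eA + (x * z) ^ 2 * eB + (x * y) ^ 2 * eC
  have hk : k ≠ 0 := by
    rintro rfl
    obtain ⟨q, hq, hqF⟩ := hWF
    obtain ⟨x, y, z, rfl⟩ := hspan q hq
    rw [hform] at hqF
    have := hsq x y z
    rw [zero_mul] at this
    exact hqF ((mul_eq_zero.1 this).resolve_left two_ne_zero)
  have hconic : ∀ p ∈ T, a * (y p * z p) + b * (x p * z p) + c * (x p * y p) = 0 := by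
    intro p hp
    have h := hsq (x p) (y p) (z p)
    rw [← hform, ← hrep p hp, eval_eq_zero_of_pderiv hF (hT p hp).2, mul_zero] at h
    exact pow_eq_zero_iff two_ne_zero |>.1 ((mul_eq_zero.1 h.symm).resolve_left hk)
  by_cases ha0 : a = 0
  · refine htwo 1 0 0 0 c b (by simp) (by tauto) fun p hp => ?_
    linear_combination hconic p hp - y p * z p * ha0
  by_cases hb0 : b = 0
  · refine htwo 0 1 0 c 0 a (by simp) (by tauto) fun p hp => ?_
    linear_combination hconic p hp - x p * z p * hb0
  by_cases hc0 : c = 0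
  · refine htwo 0 0 1 b a 0 (by simp) (by tauto) fun p hp => ?_
    linear_combination hconic p hp - x p * y p * hc0
  have := card_le_seven_of_conic hF hfin hT hli hrep ha0 hb0 hc0 hconic
  omega

end QuarticThreefold

namespace QuarticThreefold

theorem exists_linear_form (φ : (Fin 5 → ℂ) →ₗ[ℂ] ℂ) :
    ∃ L : MvPolynomial (Fin 5) ℂ, L.IsHomogeneous 1 ∧ ∀ v, eval v L = φ v := by
  refine ⟨∑ i, C (φ (Pi.single i 1)) * X i, IsHomogeneous.sum _ _ _ fun i _ => ?_, fun v => ?_⟩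
  · rw [← zero_add 1]
    exact (isHomogeneous_C _ _).mul (isHomogeneous_X _ _)
  · rw [LinearMap.pi_apply_eq_sum_univ φ v]
    simp only [map_sum, map_mul, eval_C, eval_X, smul_eq_mul, mul_comm]
    refine Finset.sum_congr rfl fun i _ => ?_
    congr 2
    ext j
    simp [Pi.single_apply, eq_comm]

theorem imposesIndependentConditions_of_separating {S : Set P4} {d : ℕ}
    (h : ∀ p ∈ S, ∃ G : MvPolynomial (Fin 5) ℂ, G.IsHomogeneous d ∧ eval p.rep G ≠ 0 ∧
      ∀ q ∈ S, q ≠ p → eval q.rep G = 0) : ImposesIndependentConditions S d := by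
  classical
  rw [ImposesIndependentConditions, linearIndependent_iff']
  intro s g hg p hp
  obtain ⟨G, hG, hGp, hGq⟩ := h p p.2
  have hcond : ∀ q : S, condition d (q : P4) ⟨G, hG⟩ = eval q.1.rep G := fun q => by
    rw [← coe_aeval_eq_eval]
    rfl
  have := congrArg (fun f => f ⟨G, hG⟩) hg
  simp only [LinearMap.sum_apply, LinearMap.smul_apply, hcond, smul_eq_mul,
    LinearMap.zero_apply] at this
  rw [Finset.sum_eq_single p (fun q _ hq => by
    rw [hGq q q.2 fun hqp => hq (Subtype.ext hqp), mul_zero]) fun hp' => absurd hp hp'] at this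
  exact (mul_eq_zero.1 this).resolve_right hGp

/-- A point outside a finite set `T` of points is separated from `T` by a product of `d` linear
forms as soon as every linear subspace through the point contains few points of `T`. -/
theorem exists_separating_form {d : ℕ} (hd : 0 < d) (p : P4) (T : Finset P4)
    (h : ∀ A ⊆ T, A.card + d ≤
      d * finrank ℂ ↥(p.submodule ⊔ Submodule.span ℂ (Projectivization.rep '' (A : Set P4)))) :
    ∃ G : MvPolynomial (Fin 5) ℂ, G.IsHomogeneous d ∧ eval p.rep G ≠ 0 ∧
      ∀ q ∈ T, eval q.rep G = 0 := by
  classical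
  have : Nonempty (Fin d) := ⟨⟨0, hd⟩⟩
  obtain ⟨c, hc⟩ := exists_coloring_independent (K := ℂ) Projectivization.rep T
    (fun _ : Fin d => p.submodule) (fun A hA => by
      simpa [Projectivization.finrank_submodule] using h A hA)
  have hφ : ∀ i, ∃ φ : (Fin 5 → ℂ) →ₗ[ℂ] ℂ, φ p.rep ≠ 0 ∧ ∀ q ∈ T, c q = i → φ q.rep = 0 := by
    intro i
    set N := Submodule.span ℂ (Projectivization.rep '' (T.filter (c · = i) : Set P4)) with hN
    have hp : p.rep ∉ N := by
      intro hp
      have hle : p.submodule ⊔ N = N := by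
        rw [sup_eq_right, Projectivization.submodule_eq, Submodule.span_singleton_le_iff_mem]
        exact hp
      have h1 := hc i
      rw [← hN, hle, Projectivization.finrank_submodule] at h1
      have h2 : finrank ℂ N ≤ (T.filter (c · = i)).card := by
        rw [hN, ← Finset.coe_image]
        exact (finrank_span_finset_le_card _).trans Finset.card_image_le
      omega
    obtain ⟨φ, hφp, hφN⟩ := Submodule.exists_le_ker_of_notMem hp
    exact ⟨φ, hφp, fun q hq hqi => hφN (Submodule.subset_span ⟨q, by simp [hq, hqi], rfl⟩)⟩
  choose φ hφp hφT using hφ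
  choose L hL hLe using fun i => exists_linear_form (φ i)
  refine ⟨∏ i, L i, ?_, ?_, fun q hq => ?_⟩
  · simpa using IsHomogeneous.prod Finset.univ L (fun _ => 1) fun i _ => hL i
  · rw [map_prod]
    exact Finset.prod_ne_zero_iff.2 fun i _ => by rw [hLe]; exact hφp i
  · rw [map_prod]
    exact Finset.prod_eq_zero (Finset.mem_univ (c q)) (by rw [hLe]; exact hφT _ q hq rfl)

end QuarticThreefold

theorem proposition2p5 (F : MvPolynomial (Fin 5) ℂ)
    (hF : QuarticThreefold.IsNodalQuartic F)
    (hcard : (QuarticThreefold.Sing F).encard ≤ 9)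
    (hplane : ¬ QuarticThreefold.ContainsPlane F) :
    QuarticThreefold.ImposesIndependentConditions (QuarticThreefold.Sing F) 3 := by
  classical
  have hfin : (QuarticThreefold.Sing F).Finite := Set.finite_of_encard_le_coe hcard
  refine QuarticThreefold.imposesIndependentConditions_of_separating fun p hp => ?_
  obtain ⟨G, hG, hGp, hGq⟩ := QuarticThreefold.exists_separating_form (d := 3) (by norm_num) p
    (hfin.toFinset.erase p) fun A hA => by
      set R := p.submodule ⊔ Submodule.span ℂ (Projectivization.rep '' (A : Set QuarticThreefold.P4)) with hR
      have hpA : p ∉ A := fun h => Finset.notMem_erase _ _ (hA h)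
      have hpR : p.submodule ≤ R := le_sup_left
      have hmem : ∀ q ∈ insert p A, q.rep ∈ R := by
        intro q hq
        rcases Finset.mem_insert.1 hq with rfl | hq
        · refine hpR ?_
          rw [Projectivization.submodule_eq]
          exact Submodule.mem_span_singleton_self _
        · exact (le_sup_right : _ ≤ R) (Submodule.subset_span ⟨q, hq, rfl⟩)
      have hSing : ∀ q ∈ insert p A, q ∈ QuarticThreefold.Sing F := by
        intro q hq
        rcases Finset.mem_insert.1 hq with rfl | hq
        · exact hp
        · exact hfin.mem_toFinset.1 (Finset.mem_of_mem_erase (hA hq))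
      have hpos : 1 ≤ finrank ℂ R := by
        rw [← p.finrank_submodule]
        exact Submodule.finrank_mono hpR
      have hinsert : (insert p A).card = A.card + 1 := Finset.card_insert_of_notMem hpA
      rcases A.eq_empty_or_nonempty with rfl | ⟨q, hq⟩
      · rw [Finset.card_empty]
        omega
      have htwo : 2 ≤ finrank ℂ R := by
        have hpq : p ≠ q := fun h => hpA (h ▸ hq)
        have hli := Projectivization.linearIndependent_pair_iff_ne.2 hpq
        rw [← Fintype.card_fin 2, ← finrank_span_eq_card hli]
        refine Submodule.finrank_mono (Submodule.span_le.2 ?_)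
        rintro _ ⟨i, rfl⟩
        fin_cases i
        exacts [hmem p (Finset.mem_insert_self ..), hmem q (Finset.mem_insert_of_mem hq)]
      rcases htwo.eq_or_lt with h2 | h2
      · have := QuarticThreefold.card_le_three_of_finrank_le_two hF.isHomogeneous hfin hSing
          h2.ge hmem
        omega
      rcases (Nat.succ_le_of_lt h2).eq_or_lt with h3 | h3
      · have := QuarticThreefold.card_le_seven_of_finrank_eq_three hF.isHomogeneous hfin hSing
          h3.symm hmem (by
            by_contra! hcon
            refine hplane ⟨R, h3.symm, fun q hq => hcon _ (hq ?_)⟩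
            rw [Projectivization.submodule_eq]
            exact Submodule.mem_span_singleton_self _)
        omega
      · have hle : (insert p A).card ≤ 9 := by
          have h1 : ((insert p A : Finset QuarticThreefold.P4) : Set QuarticThreefold.P4).encard ≤ 9 :=
            (Set.encard_le_encard fun q hq => hSing q hq).trans hcard
          rw [Set.encard_coe_eq_coe_finsetCard] at h1
          exact_mod_cast h1
        omega
  exact ⟨G, hG, hGp, fun q hq hqp => hGq q (by simp [hq, hqp])⟩
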